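/- Let $|\psi\rangle$ be an $n$-qubit stabilizer state, i.e. a normalized vector of $(\mathbb{C}^2)^{\otimes n}$ for which there are $n$ independent, pairwise commuting operators $S_1,\dots,S_n$, each of the form $\pm P_1\otimes\cdots\otimes P_n$ with $P_k\in\{I,X,Y,Z\}$ and $S_a^2=I$, such that $S_a|\psi\rangle=|\psi\rangle$ for all $a$. (Independent means that $\prod_a S_a^{r_a}=I$ with $r_a\in\{0,1\}$ only if all $r_a=0$.) A stabilizer element of $|\psi\rangle$ is an operator $\sigma=\pm P_1\otimes\cdots\otimes P_n$ with $\sigma|\psi\rangle=|\psi\rangle$; its support is $\{k : P_k\neq I\}$. A substring of $\sigma$ is an operator $\pm P_1'\otimes\cdots\otimes P_n'$, with either sign, such that $P_k'\in\{P_k,I\}$ for all $k$; it is proper if $P_k'\ne P_k$ for some $k$. Let $i\neq j$ be two qubits. Secure QKD between $i$ and $j$ is said to be possible if there is a stabilizer element $\sigma$ of $|\psi\rangle$ whose support contains $i$ and $j$ and such that no proper substring of $\sigma$ whose support contains $i$ or $j$ is a stabilizer element of $|\psi\rangle$. Theorem. Secure QKD between $i$ and $j$ is possible if and only if $|\psi\rangle$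 is not separable across any bipartition that separates $i$ from $j$, that is, if and only if there is no set of qubits $A$ with $i\in A$ and $j\notin A$ such that $|\psi\rangle=|\phi\rangle\otimes|\chi\rangle$ for a state $|\phi\rangle$ of the qubits in $A$ and a state $|\chi\rangle$ of the qubits outside $A$. -/

import Mathlib

namespace StabQKD

/-- The labels of the four single-qubit Pauli matrices (the identity included). -/
inductive Pauli where
  | I
  | X
  | Y
  | Z

/-- The single-qubit Pauli matrices. -/
noncomputable def Pauli.toMatrix : Pauli → Matrix (Fin 2) (Fin 2) ℂ
  | .I => 1
  | .X => !![0, 1; 1, 0]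
  | .Y => !![0, -Complex.I; Complex.I, 0]
  | .Z => !![1, 0; 0, -1]

/-- A vector of amplitudes, in the computational basis, on qubits labelled by `Q`. -/
abbrev Ket (Q : Type*) : Type _ := (Q → Fin 2) → ℂ

/-- A (pure, normalized) state of the qubits labelled by `Q`. -/
def IsState {Q : Type*} [Fintype Q] [DecidableEq Q] (ψ : Ket Q) : Prop :=
  ∑ x : Q → Fin 2, ‖ψ x‖ ^ 2 = 1

/-- A signed tensor product `± P₁ ⊗ ⋯ ⊗ Pₙ` of Pauli matrices, as a formal string. -/
structure SignedPauli (n : ℕ) where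
  /-- the overall sign -/
  sign : ℤˣ
  /-- the Pauli matrix acting on each qubit -/
  string : Fin n → Pauli

namespace SignedPauli

variable {n : ℕ}

/-- The operator `± P₁ ⊗ ⋯ ⊗ Pₙ` on `(ℂ²)^{⊗ n}`, as a matrix in the computational basis. -/
noncomputable def op (σ : SignedPauli n) : Matrix (Fin n → Fin 2) (Fin n → Fin 2) ℂ :=
  (((σ.sign : ℤ) : ℂ)) • Matrix.of fun x y => ∏ k, (σ.string k).toMatrix (x k) (y k)

/-- The qubits on which `σ` acts by a Pauli matrix other than the identity. -/
def support (σ : SignedPauli n) : Set (Fin n) := {k | σ.string k ≠ Pauli.I}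

/-- `σ` is an element of the stabilizer group of `ψ`. -/
def Stabilizes (σ : SignedPauli n) (ψ : Ket (Fin n)) : Prop := σ.op.mulVec ψ = ψ

/-- `η` arises from `σ` by replacing some of its tensor factors with the identity. Overall signs
are ignored: they do not matter to which Pauli measurements are perfectly correlated. -/
def IsSubstring (η σ : SignedPauli n) : Prop :=
  ∀ k, η.string k = σ.string k ∨ η.string k = Pauli.I

/-- A substring from which at least one nontrivial tensor factor of `σ` has been removed. -/
def IsProperSubstring (η σ : SignedPauli n) : Prop :=
  η.IsSubstring σ ∧ η.string ≠ σ.string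

end SignedPauli

/-- `ψ` is an `n`-qubit stabilizer state: it is fixed by `n` independent commuting signed tensor
products of Pauli matrices that square to the identity. -/
def IsStabilizerState {n : ℕ} (ψ : Ket (Fin n)) : Prop :=
  IsState ψ ∧ ∃ S : Fin n → SignedPauli n,
    (∀ a, (S a).Stabilizes ψ) ∧
    (∀ a b, (S a).op * (S b).op = (S b).op * (S a).op) ∧
    (∀ a, (S a).op * (S a).op = 1) ∧
    (∀ r : Fin n → Fin 2,
      (List.ofFn fun a => (S a).op ^ (r a : ℕ)).prod = 1 → ∀ a, r a = 0)

/-- `ψ` is separable across the bipartition of the qubits into `A` and its complement: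
`ψ = φ ⊗ χ` for a state `φ` of the qubits in `A` and a state `χ` of the other qubits. -/
def IsSeparableAcross {n : ℕ} (ψ : Ket (Fin n)) (A : Finset (Fin n)) : Prop :=
  ∃ (φ : Ket {k // k ∈ A}) (χ : Ket {k // k ∉ A}), IsState φ ∧ IsState χ ∧
    ∀ x : Fin n → Fin 2, ψ x = φ (fun k => x k) * χ (fun k => x k)

/-- `σ` is a secure choice for key distribution between qubits `i` and `j` of `ψ`: it is a
stabilizer element of `ψ` with support on `i` and `j`, and no (proper) substring of it with support
on `i` or `j` is a stabilizer element of `ψ`. -/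
def IsSecureChoice {n : ℕ} (ψ : Ket (Fin n)) (i j : Fin n) (σ : SignedPauli n) : Prop :=
  σ.Stabilizes ψ ∧ i ∈ σ.support ∧ j ∈ σ.support ∧
    ¬ ∃ η : SignedPauli n, η.IsProperSubstring σ ∧ (i ∈ η.support ∨ j ∈ η.support) ∧
      η.Stabilizes ψ

/-- Secure quantum key distribution between qubits `i` and `j` of `ψ` is possible. -/
def SecureQKDPossible {n : ℕ} (ψ : Ket (Fin n)) (i j : Fin n) : Prop :=
  ∃ σ : SignedPauli n, IsSecureChoice ψ i j σ

end StabQKD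

/-!
If `ψ` is a product across a cut that separates `i` from `j`, then each half of a stabilizer element
is a stabilizer element up to sign (`exists_stabilizes_restrict`). The half containing `i` is then a
proper substring acting on `i`, so no stabilizer element is a secure choice.

For the converse, drop signs and phases: the stabilizer elements form a group `L` of Pauli strings
under multiplication up to phase, the strings of which `ψ` is an eigenvector (`eigenGroup`). It is
isotropic (any two elements commute) and has at least `2 ^ n` elements. Such a group can be brought
into graph-state form: a `Frame` consists of a Pauli axis on each qubit and, for each qubit `v`, an
element `gen v` of `L` that is `I` or the axis on every other qubit and anticommutes with the axis
on `v`. Axes that make this possible are those for which the fewest elements of `L` are strings of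
axes and identities (`IsIsotropic.exists_axis`, `IsIsotropic.nonempty_frame`). The relation
"`gen v` acts on `k`" is symmetric and makes the qubits a graph.

Each `gen v` is minimal in `L` (`Frame.eq_zero_or_eq_gen`), so an edge between `i` and `j` in the
graph of some frame is a secure choice. Local complementation turns one frame into another, and
shortens a walk by making the two neighbours of its second vertex adjacent; so if `i` and `j` are
connected in the graph of one frame, they are adjacent in the graph of another
(`Frame.exists_gen_ne_zero`).

If they are not connected, let `A` be the component of `i`. Every `gen v` lives on `A` or on its
complement, so for fixed `y` the product of slices `ψ(x_A, y_B) ψ(y_A, x_B)` has the same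
eigenvalues as `ψ` under all generators (`tensor_mulVec_tensorKet_slices`). These eigenvalues
determine a vector up to a scalar (`Frame.exists_eq_smul`, from the completeness of the Pauli
basis), so `ψ` is a multiple of this product and hence separable across `A`.
-/

namespace StabQKD

open Matrix

/-! ### Pauli labels as a Klein four-group -/

namespace Pauli

/-- The symplectic coordinates of a Pauli label: the exponents `(a, b)` in `XᵃZᵇ`, up to phase. -/
def bits : Pauli ≃ ZMod 2 × ZMod 2 where
  toFun
    | I => (0, 0)
    | X => (1, 0)
    | Y => (1, 1)
    | Z => (0, 1)
  invFun v := if v = (0, 0) then I else if v = (1, 0) then X else if v = (1, 1) then Y else Z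
  left_inv P := by cases P <;> rfl
  right_inv v := by revert v; decide

instance : DecidableEq Pauli := bits.decidableEq

instance : Fintype Pauli := Fintype.ofEquiv _ bits.symm

/-- Multiplication of Pauli matrices up to phase, written additively. -/
instance : AddCommGroup Pauli := bits.addCommGroup

/-- `1` if the two Pauli matrices commute and `-1` if they anticommute. -/
def commSign (P Q : Pauli) : ℤˣ := if P = 0 ∨ Q = 0 ∨ P = Q then 1 else -1

theorem I_eq_zero : I = 0 := rfl

theorem add_self (P : Pauli) : P + P = 0 := by cases P <;> decide

theorem commSign_self (P : Pauli) : commSign P P = 1 := by cases P <;> decide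

theorem commSign_zero_left (P : Pauli) : commSign 0 P = 1 := by cases P <;> decide

theorem commSign_zero_right (P : Pauli) : commSign P 0 = 1 := by cases P <;> decide

theorem commSign_comm (P Q : Pauli) : commSign P Q = commSign Q P := by
  cases P <;> cases Q <;> decide

theorem commSign_add_right (P Q R : Pauli) :
    commSign P (Q + R) = commSign P Q * commSign P R := by
  cases P <;> cases Q <;> cases R <;> decide

theorem commSign_add_left (P Q R : Pauli) :
    commSign (P + Q) R = commSign P R * commSign Q R := by
  cases P <;> cases Q <;> cases R <;> decide

theorem commSign_eq_one_iff {P : Pauli} (hP : P ≠ 0) (Q : Pauli) :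
    commSign P Q = 1 ↔ Q = 0 ∨ Q = P := by
  revert hP; cases P <;> cases Q <;> decide

theorem commSign_sum_right {ι : Type*} (P : Pauli) (s : Finset ι) (f : ι → Pauli) :
    commSign P (∑ v ∈ s, f v) = ∏ v ∈ s, commSign P (f v) := by
  classical
  induction s using Finset.induction_on with
  | empty => simpa using commSign_zero_right P
  | insert a s ha ih => rw [Finset.sum_insert ha, Finset.prod_insert ha, commSign_add_right, ih]

theorem exists_mul_eq (P Q : Pauli) :
    ∃ c : ℂ, c ≠ 0 ∧ P.toMatrix * Q.toMatrix = c • (P + Q).toMatrix := by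
  cases P <;> cases Q
  case X.Y => exact ⟨Complex.I, Complex.I_ne_zero, by
    change _ = _ • Pauli.Z.toMatrix; ext a b; fin_cases a <;> fin_cases b <;> simp [toMatrix]⟩
  case Y.X => exact ⟨-Complex.I, by simp, by
    change _ = _ • Pauli.Z.toMatrix; ext a b; fin_cases a <;> fin_cases b <;> simp [toMatrix]⟩
  case Y.Z => exact ⟨Complex.I, Complex.I_ne_zero, by
    change _ = _ • Pauli.X.toMatrix; ext a b; fin_cases a <;> fin_cases b <;> simp [toMatrix]⟩
  case Z.Y => exact ⟨-Complex.I, by simp, by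
    change _ = _ • Pauli.X.toMatrix; ext a b; fin_cases a <;> fin_cases b <;> simp [toMatrix]⟩
  case Z.X => exact ⟨Complex.I, Complex.I_ne_zero, by
    change _ = _ • Pauli.Y.toMatrix; ext a b; fin_cases a <;> fin_cases b <;> simp [toMatrix]⟩
  case X.Z => exact ⟨-Complex.I, by simp, by
    change _ = _ • Pauli.Y.toMatrix; ext a b; fin_cases a <;> fin_cases b <;> simp [toMatrix]⟩
  case I.I => exact ⟨1, one_ne_zero, by change _ = _ • Pauli.I.toMatrix; simp [toMatrix]⟩
  case I.X => exact ⟨1, one_ne_zero, by change _ = _ • Pauli.X.toMatrix; simp [toMatrix]⟩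
  case X.I => exact ⟨1, one_ne_zero, by change _ = _ • Pauli.X.toMatrix; simp [toMatrix]⟩
  case I.Y => exact ⟨1, one_ne_zero, by change _ = _ • Pauli.Y.toMatrix; simp [toMatrix]⟩
  case Y.I => exact ⟨1, one_ne_zero, by change _ = _ • Pauli.Y.toMatrix; simp [toMatrix]⟩
  case I.Z => exact ⟨1, one_ne_zero, by change _ = _ • Pauli.Z.toMatrix; simp [toMatrix]⟩
  case Z.I => exact ⟨1, one_ne_zero, by change _ = _ • Pauli.Z.toMatrix; simp [toMatrix]⟩
  all_goals exact ⟨1, one_ne_zero, by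
    change _ = _ • Pauli.I.toMatrix
    ext a b; fin_cases a <;> fin_cases b <;> simp [toMatrix]⟩

theorem mul_self_eq_one (P : Pauli) : P.toMatrix * P.toMatrix = 1 := by
  cases P <;> ext a b <;> fin_cases a <;> fin_cases b <;> simp [toMatrix]

theorem mul_comm_sign (P Q : Pauli) :
    P.toMatrix * Q.toMatrix = ((commSign P Q : ℤ) : ℂ) • (Q.toMatrix * P.toMatrix) := by
  have h1 : commSign X Y = -1 := by decide
  have h2 : commSign Y X = -1 := by decide
  have h3 : commSign Y Z = -1 := by decide
  have h4 : commSign Z Y = -1 := by decide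
  have h5 : commSign X Z = -1 := by decide
  have h6 : commSign Z X = -1 := by decide
  by_cases h : P = 0 ∨ Q = 0 ∨ P = Q
  · rw [commSign, if_pos h]
    obtain rfl | rfl | rfl := h <;> simp [← I_eq_zero, toMatrix]
  · revert h
    cases P <;> cases Q <;> intro h <;> first
      | exact absurd (by decide) h
      | (simp only [h1, h2, h3, h4, h5, h6]
         ext a b; fin_cases a <;> fin_cases b <;> simp [toMatrix])

theorem star_toMatrix (P : Pauli) (a b : Fin 2) :
    star (P.toMatrix a b) = P.toMatrix b a := by
  cases P <;> fin_cases a <;> fin_cases b <;> simp [toMatrix]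

theorem sum_eq (f : Pauli → ℂ) : ∑ P, f P = f I + f X + f Y + f Z := by
  have : (Finset.univ : Finset Pauli) = {I, X, Y, Z} := by decide
  rw [this, Finset.sum_insert (by decide), Finset.sum_insert (by decide),
    Finset.sum_insert (by decide), Finset.sum_singleton]
  ring

/-- Completeness of the Pauli basis: `∑ P ⊗ P` is twice the swap operator. -/
theorem sum_toMatrix_mul (a b c d : Fin 2) :
    ∑ P : Pauli, P.toMatrix a b * P.toMatrix c d = if a = d ∧ b = c then 2 else 0 := by
  rw [sum_eq]
  fin_cases a <;> fin_cases b <;> fin_cases c <;> fin_cases d <;> norm_num [toMatrix]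

end Pauli

/-! ### Pauli strings as operators -/

section Operators

variable {Q : Type*} [Fintype Q]

/-- The unsigned tensor product of the Pauli matrices `p k`, for an arbitrary set of qubits. -/
noncomputable def tensor (p : Q → Pauli) : Matrix (Q → Fin 2) (Q → Fin 2) ℂ :=
  Matrix.of fun x y => ∏ k, (p k).toMatrix (x k) (y k)

theorem tensor_apply (p : Q → Pauli) (x y : Q → Fin 2) :
    tensor p x y = ∏ k, (p k).toMatrix (x k) (y k) := rfl

theorem star_tensor (p : Q → Pauli) (x y : Q → Fin 2) : star (tensor p x y) = tensor p y x := by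
  simp only [tensor_apply, star_prod, Pauli.star_toMatrix]

theorem conjTranspose_tensor (p : Q → Pauli) : (tensor p)ᴴ = tensor p := by
  ext x y
  rw [Matrix.conjTranspose_apply, star_tensor]

/-- `1` if the two Pauli strings commute as operators and `-1` if they anticommute. -/
def commSign (p q : Q → Pauli) : ℤˣ := ∏ k, (p k).commSign (q k)

theorem commSign_add_left (p q r : Q → Pauli) :
    commSign (p + q) r = commSign p r * commSign q r := by
  simp [commSign, Pauli.commSign_add_left, Finset.prod_mul_distrib]

variable [DecidableEq Q]

theorem tensor_mul_apply (p q : Q → Pauli) (x z : Q → Fin 2) :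
    (tensor p * tensor q) x z = ∏ k, ((p k).toMatrix * (q k).toMatrix) (x k) (z k) := by
  simp only [Matrix.mul_apply, tensor_apply, ← Finset.prod_mul_distrib]
  rw [Finset.prod_univ_sum, Fintype.piFinset_univ]

theorem tensor_zero : tensor (0 : Q → Pauli) = 1 := by
  ext x y
  simp only [tensor_apply, Pi.zero_apply, ← Pauli.I_eq_zero, Pauli.toMatrix, Matrix.one_apply,
    Finset.prod_ite_zero, Finset.prod_const_one]
  simp [funext_iff]

theorem tensor_mul_self (p : Q → Pauli) : tensor p * tensor p = 1 := by
  rw [← tensor_zero]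
  ext x y
  simp only [tensor_mul_apply, Pauli.mul_self_eq_one]
  rfl

theorem exists_tensor_mul (p q : Q → Pauli) :
    ∃ c : ℂ, c ≠ 0 ∧ tensor p * tensor q = c • tensor (p + q) := by
  choose c hc h using fun k => Pauli.exists_mul_eq (p k) (q k)
  refine ⟨∏ k, c k, Finset.prod_ne_zero_iff.2 fun k _ => hc k, ?_⟩
  ext x y
  simp [tensor_mul_apply, h, tensor_apply, Finset.prod_mul_distrib]

theorem tensor_mul_comm (p q : Q → Pauli) :
    tensor p * tensor q = ((commSign p q : ℤ) : ℂ) • (tensor q * tensor p) := by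
  ext x y
  simp only [tensor_mul_apply, Matrix.smul_apply, smul_eq_mul]
  rw [Finset.prod_congr rfl fun k _ => by rw [Pauli.mul_comm_sign (p k) (q k)]]
  simp [commSign, Finset.prod_mul_distrib]

theorem sum_tensor_mul (x y z w : Q → Fin 2) :
    ∑ p : Q → Pauli, tensor p x y * tensor p z w =
      if x = w ∧ y = z then 2 ^ Fintype.card Q else 0 := by
  simp only [tensor_apply, ← Finset.prod_mul_distrib]
  rw [← Fintype.piFinset_univ, ← Finset.prod_univ_sum
    (t := fun _ : Q => (Finset.univ : Finset Pauli))
    (f := fun k P => P.toMatrix (x k) (y k) * P.toMatrix (z k) (w k))]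
  simp only [Pauli.sum_toMatrix_mul, Finset.prod_ite_zero, Finset.prod_const, Finset.card_univ]
  simp [funext_iff, forall_and]

/-- Every vector is recovered from its Pauli matrix elements against a fixed vector `ψ`. -/
theorem sum_tensor_mulVec (ψ φ : Ket Q) :
    ∑ p : Q → Pauli, (star ψ ⬝ᵥ (tensor p *ᵥ φ)) • (tensor p *ᵥ ψ) =
      (2 ^ Fintype.card Q * (star ψ ⬝ᵥ ψ)) • φ := by
  ext z
  have h : ∀ p : Q → Pauli, ((star ψ ⬝ᵥ (tensor p *ᵥ φ)) • (tensor p *ᵥ ψ)) z =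
      ∑ x, ∑ y, ∑ w, (star (ψ x) * φ y * ψ w) * (tensor p x y * tensor p z w) := by
    intro p
    simp only [dotProduct, mulVec, Pi.smul_apply, smul_eq_mul, Pi.star_apply, Finset.sum_mul,
      Finset.mul_sum]
    rw [Finset.sum_comm]
    refine Finset.sum_congr rfl fun x _ => ?_
    rw [Finset.sum_comm]
    refine Finset.sum_congr rfl fun y _ => ?_
    refine Finset.sum_congr rfl fun w _ => ?_
    ring
  rw [Finset.sum_apply, Finset.sum_congr rfl fun p _ => h p, Finset.sum_comm]
  simp only [dotProduct, Pi.smul_apply, smul_eq_mul, Pi.star_apply, Finset.sum_mul, Finset.mul_sum]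
  refine Finset.sum_congr rfl fun x _ => ?_
  rw [Finset.sum_comm]
  have h2 : ∀ y, ∑ p : Q → Pauli, ∑ w, (star (ψ x) * φ y * ψ w) * (tensor p x y * tensor p z w) =
      if y = z then star (ψ x) * φ y * ψ x * 2 ^ Fintype.card Q else 0 := by
    intro y
    rw [Finset.sum_comm]
    simp only [← Finset.mul_sum, sum_tensor_mul]
    rw [Finset.sum_eq_single x (fun w _ hw => by simp [hw.symm]) (by simp)]
    split_ifs <;> simp_all
  simp only [h2, Finset.sum_ite_eq', Finset.mem_univ, if_true]
  ring

/-! ### Eigenvalues and the isotropic group of a family of vectors -/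

theorem eigenvalue_sq {p : Q → Pauli} {φ : Ket Q} {c : ℂ} (hφ : φ ≠ 0)
    (h : tensor p *ᵥ φ = c • φ) : c = 1 ∨ c = -1 := by
  have h2 : (c * c) • φ = (1 : ℂ) • φ := by
    rw [mul_smul, ← h, ← mulVec_smul, ← h, mulVec_mulVec, tensor_mul_self, one_mulVec, one_smul]
  exact mul_self_eq_one_iff.1 (smul_left_injective ℂ hφ h2)

/-- The Pauli strings of which all vectors of the family `Φ` are eigenvectors with one common
eigenvalue. For a single nonzero vector these are its stabilizer elements with the sign dropped. -/
def eigenGroup {ι : Type*} (Φ : ι → Ket Q) : AddSubgroup (Q → Pauli) where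
  carrier := {p | ∃ c : ℂ, ∀ a, tensor p *ᵥ Φ a = c • Φ a}
  zero_mem' := ⟨1, fun a => by rw [tensor_zero, one_mulVec, one_smul]⟩
  add_mem' := by
    rintro p q ⟨c, hc⟩ ⟨d, hd⟩
    obtain ⟨e, he, h⟩ := exists_tensor_mul p q
    refine ⟨e⁻¹ * (c * d), fun a => ?_⟩
    rw [mul_smul, eq_inv_smul_iff₀ he, ← smul_mulVec, ← h, ← mulVec_mulVec, hd, mulVec_smul, hc,
      smul_smul, mul_comm]
  neg_mem' := by
    rintro p hp
    rwa [show -p = p from neg_eq_of_add_eq_zero_left (funext fun k => Pauli.add_self (p k))]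

/-- Stabilizer elements of a nonzero vector commute. -/
theorem commSign_eq_one {ψ : Ket Q} (hψ : ψ ≠ 0) {p q : Q → Pauli} {c d : ℂ}
    (hp : tensor p *ᵥ ψ = c • ψ) (hq : tensor q *ᵥ ψ = d • ψ) : commSign p q = 1 := by
  have h : tensor p *ᵥ (tensor q *ᵥ ψ) =
      ((commSign p q : ℤ) : ℂ) • (tensor q *ᵥ (tensor p *ᵥ ψ)) := by
    rw [mulVec_mulVec, mulVec_mulVec, tensor_mul_comm, smul_mulVec]
  rw [hp, hq, mulVec_smul, mulVec_smul, hp, hq, smul_smul, smul_smul, smul_smul] at h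
  have h2 : d * c = ((commSign p q : ℤ) : ℂ) * (c * d) := by
    simpa [mul_assoc] using smul_left_injective ℂ hψ h
  have hc : c ≠ 0 := by rcases eigenvalue_sq hψ hp with rfl | rfl <;> simp
  have hd : d ≠ 0 := by rcases eigenvalue_sq hψ hq with rfl | rfl <;> simp
  rcases Int.units_eq_one_or (commSign p q) with h1 | h1
  · exact h1
  · rw [h1] at h2
    have : c * d * 2 = 0 := by
      push_cast at h2
      linear_combination h2
    simp [hc, hd] at this

/-- If `p` anticommutes with some `q` that has `ψ` and `φ` as eigenvectors with the same
eigenvalue, its matrix element between `ψ` and `φ` vanishes. -/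
theorem matrixElement_eq_zero {ψ φ : Ket Q} (hψ : ψ ≠ 0) {p q : Q → Pauli} {c : ℂ}
    (h1 : tensor q *ᵥ ψ = c • ψ) (h2 : tensor q *ᵥ φ = c • φ) (h : commSign p q ≠ 1) :
    star ψ ⬝ᵥ (tensor p *ᵥ φ) = 0 := by
  have hs : commSign p q = -1 := (Int.units_eq_one_or _).resolve_left h
  have hc := eigenvalue_sq hψ h1
  have hcc : star c = c := by rcases hc with rfl | rfl <;> simp
  have hc0 : c ≠ 0 := by rcases hc with rfl | rfl <;> simp
  -- Move the eigenvalue `c` from `φ` on the right to `ψ` on the left.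
  have key : c * (star ψ ⬝ᵥ (tensor p *ᵥ φ)) = -(c * (star ψ ⬝ᵥ (tensor p *ᵥ φ))) := by
    calc c * (star ψ ⬝ᵥ (tensor p *ᵥ φ))
        = star ψ ⬝ᵥ (tensor p *ᵥ (tensor q *ᵥ φ)) := by
          rw [h2, mulVec_smul, dotProduct_smul, smul_eq_mul]
      _ = -(star ψ ⬝ᵥ (tensor q *ᵥ (tensor p *ᵥ φ))) := by
          rw [mulVec_mulVec, mulVec_mulVec, tensor_mul_comm p q, hs, smul_mulVec, dotProduct_smul]
          simp
      _ = -(c * (star ψ ⬝ᵥ (tensor p *ᵥ φ))) := by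
          rw [dotProduct_mulVec, ← conjTranspose_tensor q, ← star_mulVec, h1, star_smul, hcc,
            smul_dotProduct, smul_eq_mul]
  have : c * (star ψ ⬝ᵥ (tensor p *ᵥ φ)) = 0 := self_eq_neg.1 key
  exact (mul_eq_zero.1 this).resolve_left hc0

end Operators

/-! ### Frames: graph-state generators of an isotropic group -/

section Frames

variable {Q : Type*} [DecidableEq Q]

/-- A graph-state form of a group `L` of Pauli strings: a nontrivial Pauli `axis k` on every qubit,
and for every qubit `v` an element `gen v` of `L` which anticommutes locally with the axis on the
qubit `v` and is `I` or the axis on every other qubit. For the standard generators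
`X_v ∏_{k ∼ v} Z_k` of a graph state all axes are `Z`. -/
structure Frame (L : AddSubgroup (Q → Pauli)) where
  /-- the local reference Pauli -/
  axis : Q → Pauli
  /-- the generator attached to a qubit -/
  gen : Q → Q → Pauli
  gen_mem : ∀ v, gen v ∈ L
  commSign_axis : ∀ v k, (axis k).commSign (gen v k) = if v = k then -1 else 1

namespace Frame

variable {L : AddSubgroup (Q → Pauli)} (F : Frame L)

theorem axis_ne_zero (k : Q) : F.axis k ≠ 0 := by
  intro h
  have := F.commSign_axis k k
  rw [h, Pauli.commSign_zero_left, if_pos rfl] at this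
  exact absurd this (by decide)

theorem gen_self_ne_zero (k : Q) : F.gen k k ≠ 0 := by
  intro h
  have := F.commSign_axis k k
  rw [h, Pauli.commSign_zero_right, if_pos rfl] at this
  exact absurd this (by decide)

theorem gen_eq_zero_or {v k : Q} (h : v ≠ k) : F.gen v k = 0 ∨ F.gen v k = F.axis k :=
  (Pauli.commSign_eq_one_iff (F.axis_ne_zero k) _).1 (by rw [F.commSign_axis, if_neg h])

/-- Local complementation at the qubit `k`: it complements the subgraph induced on the neighbours
of `k`. The generators change by a change of basis of `L`; only the axis on `k` is replaced. -/
def localCompl (k : Q) : Frame L where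
  axis := Function.update F.axis k (F.axis k + F.gen k k)
  gen v := if v ≠ k ∧ F.gen v k ≠ 0 then F.gen v + F.gen k else F.gen v
  gen_mem v := by
    split_ifs
    exacts [L.add_mem (F.gen_mem v) (F.gen_mem k), F.gen_mem v]
  commSign_axis v l := by
    rcases eq_or_ne l k with rfl | hl
    · rw [Function.update_self]
      rcases eq_or_ne v l with rfl | hv
      · simp [Pauli.commSign_add_left, F.commSign_axis, Pauli.commSign_self]
      · rcases F.gen_eq_zero_or hv with e | e
        · simp [e, hv, Pauli.commSign_zero_right]
        · simp [e, hv, F.axis_ne_zero, Pauli.commSign_self]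
    · rw [Function.update_of_ne hl]
      split_ifs <;> simp_all [Pauli.commSign_add_right, F.commSign_axis, eq_comm]

theorem localCompl_gen_of_eq_zero {v k : Q} (h : F.gen v k = 0) :
    (F.localCompl k).gen v = F.gen v := by
  simp [localCompl, h]

theorem localCompl_gen_of_ne_zero {v k : Q} (hv : v ≠ k) (h : F.gen v k ≠ 0) :
    (F.localCompl k).gen v = F.gen v + F.gen k := by
  simp [localCompl, h, hv]

/-- There is a walk of length `m` from `i` to `j` in the graph of the frame, in which `v` and `k`
are adjacent when `gen v` acts on `k`. (Every vertex has a loop.) -/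
def HasWalk (i j : Q) (m : ℕ) : Prop :=
  ∃ v : ℕ → Q, v 0 = i ∧ v m = j ∧ ∀ t < m, F.gen (v t) (v (t + 1)) ≠ 0

theorem hasWalk_refl (i : Q) : F.HasWalk i i 0 := ⟨fun _ => i, rfl, rfl, by simp⟩

variable {F}

theorem HasWalk.succ {i j k : Q} {m : ℕ} (h : F.HasWalk i j m) (hk : F.gen j k ≠ 0) :
    F.HasWalk i k (m + 1) := by
  obtain ⟨v, h0, hm, hv⟩ := h
  refine ⟨fun t => if t ≤ m then v t else k, by simp [h0], by simp, fun t ht => ?_⟩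
  rcases Nat.lt_succ_iff_lt_or_eq.1 ht with h | rfl
  · simpa [h.le, Nat.succ_le_iff.2 h] using hv t h
  · simpa [hm] using hk

variable (F)

theorem hasWalk_shortcut {v : ℕ → Q} {m a b : ℕ} (hv : ∀ t < m, F.gen (v t) (v (t + 1)) ≠ 0)
    (hab : a < b) (hb : b ≤ m) (h : F.gen (v a) (v b) ≠ 0) :
    F.HasWalk (v 0) (v m) (m - (b - a) + 1) := by
  refine ⟨fun t => if t ≤ a then v t else v (t + (b - a - 1)), by simp, ?_, fun t ht => ?_⟩
  · beta_reduce
    rw [if_neg (by omega)]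
    congr 1
    omega
  · rcases lt_trichotomy t a with h1 | rfl | h1
    · simpa only [if_pos h1.le, if_pos (Nat.succ_le_iff.2 h1)] using hv t (by omega)
    · simpa only [if_pos le_rfl, if_neg (Nat.not_succ_le_self t),
        show t + 1 + (b - t - 1) = b by omega] using h
    · have h2 : ¬ t ≤ a := by omega
      have h3 : ¬ t + 1 ≤ a := by omega
      simpa only [if_neg h2, if_neg h3, show t + 1 + (b - a - 1) = t + (b - a - 1) + 1 by omega]
        using hv (t + (b - a - 1)) (by omega)

end Frame

variable [Fintype Q]

/-- Any two elements of `L` commute as operators. -/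
def IsIsotropic (L : AddSubgroup (Q → Pauli)) : Prop :=
  ∀ p ∈ L, ∀ q ∈ L, commSign p q = 1

namespace Frame

variable {L : AddSubgroup (Q → Pauli)} (F : Frame L)

/-- A string of axes and identities that commutes with all generators is trivial. -/
theorem eq_zero_of_commSign {p : Q → Pauli} (h : ∀ k, (F.axis k).commSign (p k) = 1)
    (hc : ∀ v, commSign p (F.gen v) = 1) : p = 0 := by
  have hp := fun k => (Pauli.commSign_eq_one_iff (F.axis_ne_zero k) _).1 (h k)
  funext k
  have hk := hc k
  rw [commSign, Finset.prod_eq_single k ?_ (by simp)] at hk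
  · refine (hp k).resolve_right fun e => ?_
    rw [e, F.commSign_axis, if_pos rfl] at hk
    exact absurd hk (by decide)
  · intro l _ hl
    rcases hp l with e | e
    · rw [e, Pauli.commSign_zero_left]
    · rw [e, F.commSign_axis, if_neg hl.symm]

/-- Every Pauli string can be multiplied by generators to become a string of axes and
identities. -/
theorem exists_add_sum_gen (p : Q → Pauli) :
    ∃ S : Finset Q, ∀ k, (F.axis k).commSign ((p + ∑ v ∈ S, F.gen v) k) = 1 := by
  refine ⟨Finset.univ.filter fun v => (F.axis v).commSign (p v) = -1, fun k => ?_⟩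
  rw [Pi.add_apply, Finset.sum_apply, Pauli.commSign_add_right, Pauli.commSign_sum_right]
  simp only [F.commSign_axis, Finset.prod_ite_eq', Finset.mem_filter, Finset.mem_univ, true_and]
  rcases Int.units_eq_one_or ((F.axis k).commSign (p k)) with h | h <;> rw [h] <;> decide

/-- The generators are minimal: no proper nontrivial part of one belongs to `L`. -/
theorem eq_zero_or_eq_gen (hL : IsIsotropic L) (v : Q) {h : Q → Pauli} (hm : h ∈ L)
    (hs : ∀ k, h k = F.gen v k ∨ h k = 0) : h = 0 ∨ h = F.gen v := by
  rcases hs v with hv | hv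
  · right
    have h0 : h + F.gen v = 0 := by
      refine F.eq_zero_of_commSign (fun k => ?_)
        fun w => hL _ (L.add_mem hm (F.gen_mem v)) _ (F.gen_mem w)
      rw [Pi.add_apply]
      rcases hs k with e | e
      · rw [e, Pauli.add_self, Pauli.commSign_zero_right]
      · have hk : v ≠ k := by
          rintro rfl
          exact F.gen_self_ne_zero v (hv.symm.trans e)
        rw [e, zero_add, F.commSign_axis, if_neg hk]
    funext k
    have hk := congrFun h0 k
    rw [Pi.add_apply, Pi.zero_apply] at hk
    exact add_right_cancel (hk.trans (Pauli.add_self _).symm)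
  · left
    refine F.eq_zero_of_commSign (fun k => ?_) fun w => hL _ hm _ (F.gen_mem w)
    rcases eq_or_ne v k with rfl | hk
    · rw [hv, Pauli.commSign_zero_right]
    · rcases hs k with e | e
      · rw [e, F.commSign_axis, if_neg hk]
      · rw [e, Pauli.commSign_zero_right]

theorem gen_eq_zero_of_symm (hL : IsIsotropic L) {v k : Q} (h : F.gen k v = 0) :
    F.gen v k = 0 := by
  have hvk : v ≠ k := by
    rintro rfl
    exact F.gen_self_ne_zero v h
  have hc := hL _ (F.gen_mem v) _ (F.gen_mem k)
  rw [commSign, Finset.prod_eq_mul v k hvk ?_ (by simp) (by simp)] at hc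
  · rw [h, Pauli.commSign_zero_right, one_mul] at hc
    refine (F.gen_eq_zero_or hvk).resolve_right fun e => ?_
    rw [e, F.commSign_axis, if_pos rfl] at hc
    exact absurd hc (by decide)
  · rintro l - ⟨hl1, hl2⟩
    rcases F.gen_eq_zero_or hl1.symm with e | e
    · rw [e, Pauli.commSign_zero_left]
    · rw [e, F.commSign_axis, if_neg hl2.symm]

/-- If `j` is connected to `i` in the graph of some frame, then it is adjacent to `i` in the graph
of some frame. Local complementation at the second vertex of a walk that is shortest among all
frames would shorten it. -/
theorem exists_gen_ne_zero (hL : IsIsotropic L) {i j : Q} (hij : i ≠ j) {m : ℕ}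
    (h : F.HasWalk i j m) : ∃ F' : Frame L, F'.gen i j ≠ 0 := by
  classical
  have hex : ∃ m, ∃ F : Frame L, F.HasWalk i j m := ⟨m, F, h⟩
  obtain ⟨F, hF⟩ := Nat.find_spec hex
  have hmin : ∀ l (F' : Frame L), F'.HasWalk i j l → Nat.find hex ≤ l :=
    fun l F' h => Nat.find_min' hex ⟨F', h⟩
  generalize Nat.find hex = m at hF hmin
  obtain ⟨v, h0, hm, hv⟩ := hF
  obtain rfl | rfl | hm2 : m = 0 ∨ m = 1 ∨ 2 ≤ m := by omega
  · exact absurd (h0.symm.trans hm) hij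
  · exact ⟨F, by simpa [h0, hm] using hv 0 one_pos⟩
  exfalso
  have hshort : ∀ a b, a + 2 ≤ b → b ≤ m → F.gen (v a) (v b) = 0 := by
    intro a b hab hb
    by_contra hne
    have := hmin _ F (by simpa [h0, hm] using F.hasWalk_shortcut hv (by omega) hb hne)
    omega
  have hlen := hmin (m - 1) (F.localCompl (v 1))
    ⟨fun t => if t = 0 then v 0 else v (t + 1), by simp [h0], ?_, fun t ht => ?_⟩
  · omega
  · beta_reduce
    rw [if_neg (by omega), show m - 1 + 1 = m by omega, hm]
  · rcases Nat.eq_zero_or_pos t with rfl | htpos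
    · have h02 := hshort 0 2 le_rfl hm2
      have h12 := hv 1 (by omega)
      have h01 : v 0 ≠ v 1 := by
        intro e
        rw [e] at h02
        exact h12 h02
      simp only [if_true, zero_add, one_ne_zero, if_false]
      rw [F.localCompl_gen_of_ne_zero h01 (hv 0 (by omega)), Pi.add_apply, h02, zero_add]
      exact h12
    · have h1 := F.gen_eq_zero_of_symm hL (hshort 1 (t + 1 + 1) (by omega) (by omega))
      beta_reduce
      rw [if_neg (by omega), if_neg (by omega)]
      intro h2
      have h3 := (F.localCompl (v 1)).gen_eq_zero_of_symm hL h2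
      rw [F.localCompl_gen_of_eq_zero h1] at h3
      exact hv (t + 1) (by omega) (F.gen_eq_zero_of_symm hL h3)

end Frame

/-- Every isotropic group has a choice of axes for which no nontrivial element is a string of axes
and identities. -/
theorem IsIsotropic.exists_axis {L : AddSubgroup (Q → Pauli)} (hL : IsIsotropic L) :
    ∃ T : Q → Pauli, (∀ k, T k ≠ 0) ∧ ∀ p ∈ L, (∀ k, (T k).commSign (p k) = 1) → p = 0 := by
  classical
  let B : (Q → Pauli) → Finset (Q → Pauli) := fun T =>
    Finset.univ.filter fun p => p ∈ L ∧ ∀ k, (T k).commSign (p k) = 1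
  obtain ⟨T, hT, hmin⟩ := Finset.exists_min_image
    (Finset.univ.filter fun T : Q → Pauli => ∀ k, T k ≠ 0) (fun T => (B T).card)
    ⟨fun _ => Pauli.X, by
      simpa only [Finset.mem_filter, Finset.mem_univ, true_and] using fun _ => by decide⟩
  simp only [Finset.mem_filter, Finset.mem_univ, true_and] at hT hmin
  refine ⟨T, hT, fun p hp hpT => ?_⟩
  by_contra hne
  obtain ⟨k, hk⟩ := Function.ne_iff.1 hne
  have hpk : p k = T k := ((Pauli.commSign_eq_one_iff (hT k) _).1 (hpT k)).resolve_left hk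
  -- Turning the axis on a qubit in the support of `p` removes `p` and adds nothing, since a new
  -- element would anticommute with `p`.
  obtain ⟨P, hP0, hPT⟩ : ∃ P : Pauli, P ≠ 0 ∧ P.commSign (T k) = -1 := by
    have := hT k
    revert this
    generalize T k = R
    revert R
    decide
  refine absurd (hmin (Function.update T k P) fun l => ?_) (not_le.2 (Finset.card_lt_card ?_))
  · rcases eq_or_ne l k with rfl | hl
    · rwa [Function.update_self]
    · rw [Function.update_of_ne hl]
      exact hT l
  · rw [Finset.ssubset_iff_of_subset]
    · refine ⟨p, by simp [B, hp, hpT], ?_⟩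
      simp only [B, Finset.mem_filter, Finset.mem_univ, true_and, not_and, not_forall]
      refine fun _ => ⟨k, ?_⟩
      rw [Function.update_self, hpk, hPT]
      decide
    · intro d hd
      simp only [B, Finset.mem_filter, Finset.mem_univ, true_and] at hd ⊢
      obtain ⟨hdL, hd⟩ := hd
      have hdl : ∀ l, l ≠ k → (T l).commSign (d l) = 1 := fun l hl => by
        simpa [Function.update_of_ne hl] using hd l
      refine ⟨hdL, fun l => ?_⟩
      rcases eq_or_ne l k with rfl | hl
      · have hdk := hd l
        rw [Function.update_self] at hdk
        rcases (Pauli.commSign_eq_one_iff hP0 _).1 hdk with e | e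
        · rw [e, Pauli.commSign_zero_right]
        · have hc := hL p hp d hdL
          rw [commSign, Finset.prod_eq_single l ?_ (by simp), hpk, e, Pauli.commSign_comm,
            hPT] at hc
          · exact absurd hc (by decide)
          · intro r _ hr
            rcases (Pauli.commSign_eq_one_iff (hT r) _).1 (hpT r) with e' | e'
            · rw [e', Pauli.commSign_zero_left]
            · rw [e', hdl r hr]
      · exact hdl l hl

/-- An isotropic group with at least `2 ^ |Q|` elements has a frame: its elements are determined
by their commutation signs with the axes, and counting shows that all sign patterns occur. -/
theorem IsIsotropic.nonempty_frame {L : AddSubgroup (Q → Pauli)} (hL : IsIsotropic L)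
    (f : (Q → Fin 2) → L) (hf : Function.Injective f) : Nonempty (Frame L) := by
  obtain ⟨T, -, hT⟩ := hL.exists_axis
  let s : (Q → Fin 2) → Q → ℤˣ := fun r k => (T k).commSign ((f r : Q → Pauli) k)
  have hs : Function.Injective s := by
    intro r r' h
    refine hf (Subtype.ext ?_)
    have h0 := hT _ (L.add_mem (f r).2 (f r').2) fun k => by
      rw [Pi.add_apply, Pauli.commSign_add_right, show (T k).commSign ((f r : Q → Pauli) k) =
        (T k).commSign ((f r' : Q → Pauli) k) from congrFun h k, Int.units_mul_self]
    funext k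
    have hk := congrFun h0 k
    rw [Pi.add_apply, Pi.zero_apply] at hk
    exact add_right_cancel (hk.trans (Pauli.add_self _).symm)
  have hbij : Function.Bijective s :=
    (Fintype.bijective_iff_injective_and_card s).2 ⟨hs, by simp⟩
  choose g hg using fun v : Q => hbij.2 fun k => if v = k then -1 else 1
  exact ⟨⟨T, fun v => f (g v), fun v => (f (g v)).2, fun v k => congrFun (hg v) k⟩⟩

end Frames

/-! ### Separating the qubits of a frame -/

section Separation

variable {Q : Type*} [DecidableEq Q]

variable (A : Finset Q)

/-- The basis label that agrees with `a` on `A` and with `b` outside `A`. -/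
def merge (a : {k // k ∈ A} → Fin 2) (b : {k // k ∉ A} → Fin 2) : Q → Fin 2 :=
  (Equiv.piEquivPiSubtypeProd (· ∈ A) fun _ => Fin 2).symm (a, b)

/-- The tensor product of a ket on `A` and a ket on the complement of `A`. -/
def tensorKet (φ : Ket {k // k ∈ A}) (χ : Ket {k // k ∉ A}) : Ket Q :=
  fun x => φ (fun k => x k) * χ (fun k => x k)

variable {A}

theorem merge_mem (a : {k // k ∈ A} → Fin 2) (b : {k // k ∉ A} → Fin 2) (k : {k // k ∈ A}) :
    merge A a b k = a k := by
  simp [merge, Equiv.piEquivPiSubtypeProd, k.2]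

theorem merge_notMem (a : {k // k ∈ A} → Fin 2) (b : {k // k ∉ A} → Fin 2) (k : {k // k ∉ A}) :
    merge A a b k = b k := by
  simp [merge, Equiv.piEquivPiSubtypeProd, k.2]

theorem merge_restrict (x : Q → Fin 2) :
    merge A (fun k => x k) (fun k => x k) = x :=
  (Equiv.piEquivPiSubtypeProd (· ∈ A) fun _ => Fin 2).symm_apply_apply x

theorem tensorKet_merge (φ : Ket {k // k ∈ A}) (χ : Ket {k // k ∉ A})
    (a : {k // k ∈ A} → Fin 2) (b : {k // k ∉ A} → Fin 2) :
    tensorKet A φ χ (merge A a b) = φ a * χ b := by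
  simp only [tensorKet, merge_mem, merge_notMem]

theorem ket_ext_merge {φ ψ : Ket Q} (h : ∀ a b, φ (merge A a b) = ψ (merge A a b)) : φ = ψ := by
  funext x
  rw [← merge_restrict (A := A) x]
  exact h _ _

variable [Fintype Q]

open scoped ComplexOrder in
/-- A vector that shares all eigenvalues of the generators with `ψ` is a multiple of `ψ`. In the
expansion of `φ` over Pauli strings, a string that anticommutes with a generator has vanishing
coefficient, and any other is a product of generators and so maps `ψ` to a multiple of itself. -/
theorem Frame.exists_eq_smul {ψ φ : Ket Q} (hψ : ψ ≠ 0) (F : Frame (eigenGroup fun _ : Unit => ψ))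
    (h : ∀ v, ∃ c : ℂ, tensor (F.gen v) *ᵥ ψ = c • ψ ∧ tensor (F.gen v) *ᵥ φ = c • φ) :
    ∃ c : ℂ, φ = c • ψ := by
  have hgen : ∀ v, F.gen v ∈ eigenGroup ![ψ, φ] := fun v => by
    obtain ⟨c, h1, h2⟩ := h v
    exact ⟨c, Fin.forall_fin_two.2 ⟨h1, h2⟩⟩
  have hterm : ∀ p : Q → Pauli, ∃ e : ℂ,
      (star ψ ⬝ᵥ (tensor p *ᵥ φ)) • (tensor p *ᵥ ψ) = e • ψ := by
    intro p
    by_cases hp : ∃ v, commSign p (F.gen v) ≠ 1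
    · obtain ⟨v, hv⟩ := hp
      obtain ⟨c, h1, h2⟩ := h v
      exact ⟨0, by rw [matrixElement_eq_zero hψ h1 h2 hv, zero_smul, zero_smul]⟩
    · push Not at hp
      obtain ⟨S, hS⟩ := F.exists_add_sum_gen p
      have hsum := AddSubgroup.sum_mem _ fun v (_ : v ∈ S) => hgen v
      obtain ⟨d, hd⟩ := hsum
      have h0 := F.eq_zero_of_commSign hS fun v => by
        obtain ⟨c, h1, -⟩ := h v
        rw [commSign_add_left, hp v, one_mul]
        exact commSign_eq_one hψ (hd 0) h1
      obtain ⟨c, hc⟩ : p ∈ eigenGroup ![ψ, φ] := by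
        rw [eq_neg_of_add_eq_zero_left h0]
        exact AddSubgroup.neg_mem _ ⟨d, hd⟩
      have hc0 : tensor p *ᵥ ψ = c • ψ := hc 0
      exact ⟨_, by rw [hc0, smul_smul]⟩
  choose e he using hterm
  have hsum := sum_tensor_mulVec ψ φ
  rw [Finset.sum_congr rfl fun p _ => he p, ← Finset.sum_smul] at hsum
  have hne : (2 ^ Fintype.card Q * (star ψ ⬝ᵥ ψ) : ℂ) ≠ 0 :=
    mul_ne_zero (by simp) (by rwa [Ne, dotProduct_star_self_eq_zero])
  exact ⟨(2 ^ Fintype.card Q * (star ψ ⬝ᵥ ψ) : ℂ)⁻¹ * ∑ p, e p, by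
    rw [mul_smul, hsum, inv_smul_smul₀ hne]⟩

theorem sum_merge {M : Type*} [AddCommMonoid M] (f : (Q → Fin 2) → M) :
    ∑ x, f x = ∑ a, ∑ b, f (merge A a b) := by
  rw [← (Equiv.piEquivPiSubtypeProd (· ∈ A) fun _ : Q => Fin 2).symm.sum_comp,
    Fintype.sum_prod_type]
  rfl

theorem tensor_merge (p : Q → Pauli) (a a' : {k // k ∈ A} → Fin 2) (b b' : {k // k ∉ A} → Fin 2) :
    tensor p (merge A a b) (merge A a' b') =
      tensor (fun k : {k // k ∈ A} => p k) a a' * tensor (fun k : {k // k ∉ A} => p k) b b' := by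
  simp only [tensor_apply]
  rw [← Fintype.prod_subtype_mul_prod_subtype (· ∈ A)]
  simp only [merge_mem, merge_notMem]
  congr!

theorem tensor_mulVec_merge (p : Q → Pauli) (ψ : Ket Q) (a : {k // k ∈ A} → Fin 2)
    (b : {k // k ∉ A} → Fin 2) :
    (tensor p *ᵥ ψ) (merge A a b) = ∑ a', ∑ b', tensor (fun k : {k // k ∈ A} => p k) a a' *
      tensor (fun k : {k // k ∉ A} => p k) b b' * ψ (merge A a' b') := by
  rw [mulVec, dotProduct, sum_merge (A := A)]
  simp only [tensor_merge]

theorem tensor_mulVec_tensorKet (p : Q → Pauli) (φ : Ket {k // k ∈ A}) (χ : Ket {k // k ∉ A}) :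
    tensor p *ᵥ tensorKet A φ χ = tensorKet A (tensor (fun k : {k // k ∈ A} => p k) *ᵥ φ)
      (tensor (fun k : {k // k ∉ A} => p k) *ᵥ χ) := by
  refine ket_ext_merge (A := A) fun a b => ?_
  rw [tensor_mulVec_merge, tensorKet_merge, mulVec, mulVec, dotProduct, dotProduct,
    Finset.sum_mul_sum]
  refine Finset.sum_congr rfl fun a' _ => Finset.sum_congr rfl fun b' _ => ?_
  rw [tensorKet_merge]
  ring

/-- A Pauli string supported on `A` acts on `ψ` as it acts on its slices along `A`. -/
theorem tensor_mulVec_slice {p : Q → Pauli} (hp : ∀ k ∉ A, p k = 0) (ψ : Ket Q)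
    (a : {k // k ∈ A} → Fin 2) (b : {k // k ∉ A} → Fin 2) :
    (tensor (fun k : {k // k ∈ A} => p k) *ᵥ fun a => ψ (merge A a b)) a =
      (tensor p *ᵥ ψ) (merge A a b) := by
  have h0 : (fun k : {k // k ∉ A} => p k) = 0 := funext fun k => hp k k.2
  rw [tensor_mulVec_merge, h0, tensor_zero]
  simp [Matrix.one_apply, mulVec, dotProduct]

/-- A Pauli string supported outside `A` acts on `ψ` as it acts on its slices along the
complement of `A`. -/
theorem tensor_mulVec_slice_compl {p : Q → Pauli} (hp : ∀ k ∈ A, p k = 0) (ψ : Ket Q)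
    (a : {k // k ∈ A} → Fin 2) (b : {k // k ∉ A} → Fin 2) :
    (tensor (fun k : {k // k ∉ A} => p k) *ᵥ fun b => ψ (merge A a b)) b =
      (tensor p *ᵥ ψ) (merge A a b) := by
  have h0 : (fun k : {k // k ∈ A} => p k) = 0 := funext fun k => hp k k.2
  rw [tensor_mulVec_merge, h0, tensor_zero]
  simp [Matrix.one_apply, mulVec, dotProduct]

/-- The product of two slices of `ψ` through a common label is an eigenvector of every Pauli
string supported on one side, with the same eigenvalue as `ψ`. -/
theorem tensor_mulVec_tensorKet_slices {p : Q → Pauli}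
    (hp : (∀ k ∉ A, p k = 0) ∨ ∀ k ∈ A, p k = 0) {ψ : Ket Q} {c : ℂ}
    (h : tensor p *ᵥ ψ = c • ψ) (a₀ : {k // k ∈ A} → Fin 2) (b₀ : {k // k ∉ A} → Fin 2) :
    tensor p *ᵥ tensorKet A (fun a => ψ (merge A a b₀)) (fun b => ψ (merge A a₀ b)) =
      c • tensorKet A (fun a => ψ (merge A a b₀)) fun b => ψ (merge A a₀ b) := by
  refine ket_ext_merge (A := A) fun a b => ?_
  rw [tensor_mulVec_tensorKet, tensorKet_merge, Pi.smul_apply, tensorKet_merge]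
  rcases hp with hp | hp
  · have h0 : (fun k : {k // k ∉ A} => p k) = 0 := funext fun k => hp k k.2
    rw [tensor_mulVec_slice hp, h, h0, tensor_zero, one_mulVec, Pi.smul_apply, smul_mul_assoc]
  · have h0 : (fun k : {k // k ∈ A} => p k) = 0 := funext fun k => hp k k.2
    rw [tensor_mulVec_slice_compl hp, h, h0, tensor_zero, one_mulVec, Pi.smul_apply,
      mul_smul_comm]

/-- If every generator of a frame is supported on one side of the cut, the vector is a product. -/
theorem Frame.exists_eq_tensorKet {ψ : Ket Q} (hψ : ψ ≠ 0)
    (F : Frame (eigenGroup fun _ : Unit => ψ))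
    (h : ∀ v, (∀ k ∉ A, F.gen v k = 0) ∨ ∀ k ∈ A, F.gen v k = 0) :
    ∃ φ χ, ψ = tensorKet A φ χ := by
  obtain ⟨x, hx⟩ := Function.ne_iff.1 hψ
  rw [← merge_restrict (A := A) x] at hx
  set a₀ : {k // k ∈ A} → Fin 2 := fun k => x k
  set b₀ : {k // k ∉ A} → Fin 2 := fun k => x k
  obtain ⟨c, hc⟩ := F.exists_eq_smul hψ
    (φ := tensorKet A (fun a => ψ (merge A a b₀)) fun b => ψ (merge A a₀ b)) fun v => by
      obtain ⟨c, hc⟩ := F.gen_mem v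
      exact ⟨c, hc (), tensor_mulVec_tensorKet_slices (h v) (hc ()) a₀ b₀⟩
  have hc0 : c ≠ 0 := by
    rintro rfl
    have := congrFun hc (merge A a₀ b₀)
    rw [tensorKet_merge, zero_smul] at this
    exact hx (mul_self_eq_zero.1 this)
  refine ⟨c⁻¹ • fun a => ψ (merge A a b₀), fun b => ψ (merge A a₀ b), ?_⟩
  refine ket_ext_merge (A := A) fun a b => ?_
  have := congrFun hc (merge A a b)
  rw [tensorKet_merge, Pi.smul_apply, smul_eq_mul] at this
  rw [tensorKet_merge, Pi.smul_apply, smul_eq_mul, mul_assoc, this, inv_mul_cancel_left₀ hc0]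

theorem IsState.ne_zero {ψ : Ket Q} (h : IsState ψ) : ψ ≠ 0 := by
  rintro rfl
  simp [IsState] at h

/-- The factors of a normalized product can be normalized. -/
theorem exists_isState_factors {φ : Ket {k // k ∈ A}} {χ : Ket {k // k ∉ A}}
    (h : IsState (tensorKet A φ χ)) :
    ∃ φ' χ', IsState φ' ∧ IsState χ' ∧ tensorKet A φ χ = tensorKet A φ' χ' := by
  set s := ∑ a, ‖φ a‖ ^ 2 with hs
  set t := ∑ b, ‖χ b‖ ^ 2 with ht
  have hst : s * t = 1 := by
    rw [← h, sum_merge (A := A), hs, ht, Finset.sum_mul_sum]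
    simp only [tensorKet_merge, norm_mul, mul_pow]
  have hs0 : 0 ≤ s := Finset.sum_nonneg fun _ _ => by positivity
  have ht0 : 0 ≤ t := Finset.sum_nonneg fun _ _ => by positivity
  have hsqrt : Real.sqrt s * Real.sqrt t = 1 := by
    rw [← Real.sqrt_mul hs0, hst, Real.sqrt_one]
  refine ⟨((Real.sqrt t : ℝ) : ℂ) • φ, ((Real.sqrt s : ℝ) : ℂ) • χ, ?_, ?_, ?_⟩
  · simp only [IsState, Pi.smul_apply, norm_smul, mul_pow, ← Finset.mul_sum, Complex.norm_real,
      Real.norm_eq_abs, sq_abs, Real.sq_sqrt ht0, ← hs]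
    rw [mul_comm, hst]
  · simp only [IsState, Pi.smul_apply, norm_smul, mul_pow, ← Finset.mul_sum, Complex.norm_real,
      Real.norm_eq_abs, sq_abs, Real.sq_sqrt hs0, ← ht]
    exact hst
  · refine ket_ext_merge (A := A) fun a b => ?_
    have hC : ((Real.sqrt s : ℝ) : ℂ) * ((Real.sqrt t : ℝ) : ℂ) = 1 := by exact_mod_cast hsqrt
    simp only [tensorKet_merge, Pi.smul_apply, smul_eq_mul]
    linear_combination (-(φ a * χ b)) * hC

end Separation

/-! ### Stabilizer states -/

variable {n : ℕ}

theorem SignedPauli.op_eq (σ : SignedPauli n) :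
    σ.op = ((σ.sign : ℤ) : ℂ) • tensor σ.string := rfl

theorem SignedPauli.stabilizes_iff {σ : SignedPauli n} {ψ : Ket (Fin n)} :
    σ.Stabilizes ψ ↔ tensor σ.string *ᵥ ψ = ((σ.sign : ℤ) : ℂ) • ψ := by
  rw [SignedPauli.Stabilizes, SignedPauli.op_eq, smul_mulVec]
  rcases Int.units_eq_one_or σ.sign with h | h
  · simp [h]
  · simp [h, neg_eq_iff_eq_neg]

theorem SignedPauli.Stabilizes.string_mem {σ : SignedPauli n} {ψ : Ket (Fin n)}
    (h : σ.Stabilizes ψ) : σ.string ∈ eigenGroup fun _ : Unit => ψ :=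
  ⟨_, fun _ => stabilizes_iff.1 h⟩

theorem exists_stabilizes {ψ : Ket (Fin n)} (hψ : ψ ≠ 0) {p : Fin n → Pauli} {c : ℂ}
    (hp : tensor p *ᵥ ψ = c • ψ) : ∃ s, (⟨s, p⟩ : SignedPauli n).Stabilizes ψ := by
  rcases eigenvalue_sq hψ hp with rfl | rfl
  · exact ⟨1, SignedPauli.stabilizes_iff.2 (by simpa using hp)⟩
  · exact ⟨-1, SignedPauli.stabilizes_iff.2 (by simpa using hp)⟩

/-- A product of stabilizer elements fixes `ψ` and is, up to phase, the tensor product of the sum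
of their strings. -/
theorem prod_op_pow {ψ : Ket (Fin n)} {m : ℕ} (S : Fin m → SignedPauli n)
    (hS : ∀ a, (S a).Stabilizes ψ) (r : Fin m → Fin 2) :
    (List.ofFn fun a => (S a).op ^ (r a : ℕ)).prod *ᵥ ψ = ψ ∧
      ∃ c : ℂ, (List.ofFn fun a => (S a).op ^ (r a : ℕ)).prod =
        c • tensor (∑ a, (r a : ℕ) • (S a).string) := by
  induction m with
  | zero => exact ⟨by simp, 1, by simp [tensor_zero]⟩
  | succ m ih =>
    obtain ⟨h1, c, hc⟩ := ih (fun a => S a.succ) (fun a => hS a.succ) fun a => r a.succ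
    have h0 : (S 0).op ^ (r 0 : ℕ) *ᵥ ψ = ψ ∧ ∃ d : ℂ, (S 0).op ^ (r 0 : ℕ) =
        d • tensor ((r 0 : ℕ) • (S 0).string) := by
      generalize r 0 = r0
      fin_cases r0
      · exact ⟨by simp, 1, by simp [tensor_zero]⟩
      · exact ⟨by simpa using! hS 0, _, by simpa using (S 0).op_eq⟩
    obtain ⟨h2, d, hd⟩ := h0
    rw [List.ofFn_succ, List.prod_cons, Fin.sum_univ_succ]
    refine ⟨by rw [← mulVec_mulVec, h1, h2], ?_⟩
    obtain ⟨e, -, he⟩ := exists_tensor_mul ((r 0 : ℕ) • (S 0).string)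
      (∑ a : Fin m, (r a.succ : ℕ) • (S a.succ).string)
    exact ⟨d * c * e, by rw [hd, hc, smul_mul_smul_comm, he, smul_smul]⟩

theorem isIsotropic_eigenGroup {Q : Type*} [Fintype Q] [DecidableEq Q] {ψ : Ket Q} (hψ : ψ ≠ 0) :
    IsIsotropic (eigenGroup fun _ : Unit => ψ) := by
  rintro p ⟨c, hp⟩ q ⟨d, hq⟩
  exact commSign_eq_one hψ (hp ()) (hq ())

/-- Independence of the stabilizer generators makes the stabilizer group large enough for a
frame. -/
theorem IsStabilizerState.nonempty_frame {ψ : Ket (Fin n)} (h : IsStabilizerState ψ) :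
    Nonempty (Frame (eigenGroup fun _ : Unit => ψ)) := by
  obtain ⟨hψ, S, hS, -, -, hind⟩ := h
  refine (isIsotropic_eigenGroup hψ.ne_zero).nonempty_frame
    (fun r => ⟨∑ a, (r a : ℕ) • (S a).string,
      AddSubgroup.sum_mem _ fun a _ => AddSubgroup.nsmul_mem _ (hS a).string_mem _⟩) ?_
  intro r r' hrr
  have hrr' : ∑ a, (r a : ℕ) • (S a).string = ∑ a, (r' a : ℕ) • (S a).string :=
    congrArg Subtype.val hrr
  have hsum : ∑ a, ((r a + r' a : Fin 2) : ℕ) • (S a).string = 0 := by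
    have hadd : ∀ (b b' : Fin 2) (p : Fin n → Pauli),
        ((b + b' : Fin 2) : ℕ) • p = (b : ℕ) • p + (b' : ℕ) • p := by
      intro b b' p
      have hpp : p + p = 0 := funext fun k => Pauli.add_self (p k)
      fin_cases b <;> fin_cases b' <;> simp [hpp]
    simp only [hadd, Finset.sum_add_distrib, hrr']
    exact funext fun k => Pauli.add_self _
  obtain ⟨h1, c, hc⟩ := prod_op_pow S hS fun a => r a + r' a
  rw [hsum, tensor_zero] at hc
  -- The phase is `1`, because the product fixes `ψ`.
  have hc1 : c = 1 := by
    rw [hc, smul_mulVec, one_mulVec] at h1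
    exact smul_left_injective ℂ hψ.ne_zero (h1.trans (one_smul ℂ ψ).symm)
  have h0 := hind (fun a => r a + r' a) (by rw [hc, hc1, one_smul])
  funext a
  have ha := h0 a
  revert ha
  generalize r a = b
  generalize r' a = b'
  revert b b'
  decide

/-- A generator attached to `i` that acts on `j` is a secure choice, because it is minimal. -/
theorem Frame.secureQKDPossible {ψ : Ket (Fin n)} (hψ : ψ ≠ 0)
    (F : Frame (eigenGroup fun _ : Unit => ψ)) {i j : Fin n} (h : F.gen i j ≠ 0) :
    SecureQKDPossible ψ i j := by
  obtain ⟨c, hc⟩ := F.gen_mem i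
  obtain ⟨s, hs⟩ := exists_stabilizes hψ (hc ())
  refine ⟨⟨s, F.gen i⟩, hs, F.gen_self_ne_zero i, h, ?_⟩
  rintro ⟨η, ⟨hsub, hne⟩, hsupp, hη⟩
  rcases F.eq_zero_or_eq_gen (isIsotropic_eigenGroup hψ) i hη.string_mem hsub with h0 | h0
  · rcases hsupp with hk | hk <;> exact hk (congrFun h0 _)
  · exact hne h0

/-- Across a cut, either half of a stabilizer element of a product state is itself one, up to
sign. -/
theorem exists_stabilizes_restrict {A : Finset (Fin n)} {φ : Ket {k // k ∈ A}}
    {χ : Ket {k // k ∉ A}} (h0 : tensorKet A φ χ ≠ 0) {σ : SignedPauli n}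
    (hσ : σ.Stabilizes (tensorKet A φ χ)) :
    ∃ s, (⟨s, fun k => if k ∈ A then σ.string k else 0⟩ : SignedPauli n).Stabilizes
      (tensorKet A φ χ) := by
  rw [SignedPauli.stabilizes_iff, tensor_mulVec_tensorKet] at hσ
  obtain ⟨x, hx⟩ := Function.ne_iff.1 h0
  set φ' := tensor (fun k : {k // k ∈ A} => σ.string k) *ᵥ φ
  set χ' := tensor (fun k : {k // k ∉ A} => σ.string k) *ᵥ χ
  set b₀ : {k // k ∉ A} → Fin 2 := fun k => x k
  have hval : ∀ a, φ' a * χ' b₀ = ((σ.sign : ℤ) : ℂ) * (φ a * χ b₀) := fun a => by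
    simpa only [tensorKet_merge, Pi.smul_apply, smul_eq_mul] using congrFun hσ (merge A a b₀)
  have hsign : ((σ.sign : ℤ) : ℂ) ≠ 0 := by
    rcases Int.units_eq_one_or σ.sign with h | h <;> simp [h]
  have hb : χ' b₀ ≠ 0 := by
    intro e
    have := hval fun k => x k
    rw [e, mul_zero] at this
    exact mul_ne_zero hsign hx this.symm
  have hφ : φ' = (((σ.sign : ℤ) : ℂ) * χ b₀ / χ' b₀) • φ := by
    funext a
    rw [Pi.smul_apply, smul_eq_mul, div_mul_eq_mul_div, eq_div_iff hb, hval]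
    ring
  refine exists_stabilizes h0 (c := ((σ.sign : ℤ) : ℂ) * χ b₀ / χ' b₀) ?_
  rw [tensor_mulVec_tensorKet]
  have h1 : (fun k : {k // k ∈ A} => if (k : Fin n) ∈ A then σ.string k else 0) =
      fun k : {k // k ∈ A} => σ.string k := funext fun k => if_pos k.2
  have h2 : (fun k : {k // k ∉ A} => if (k : Fin n) ∈ A then σ.string k else 0) = 0 :=
    funext fun k => if_neg k.2
  rw [h1, h2, tensor_zero, one_mulVec]
  refine ket_ext_merge (A := A) fun a b => ?_
  rw [tensorKet_merge, Pi.smul_apply, tensorKet_merge, show tensor _ *ᵥ φ = φ' from rfl, hφ,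
    Pi.smul_apply, smul_mul_assoc]

end StabQKD

theorem theorem3 (n : ℕ) (ψ : StabQKD.Ket (Fin n)) (hψ : StabQKD.IsStabilizerState ψ)
    (i j : Fin n) (hij : i ≠ j) :
    StabQKD.SecureQKDPossible ψ i j ↔
      ¬ ∃ A : Finset (Fin n), i ∈ A ∧ j ∉ A ∧ StabQKD.IsSeparableAcross ψ A := by
  classical
  have hψ0 := hψ.1.ne_zero
  constructor
  · rintro ⟨σ, hσ, hi, hj, hmin⟩ ⟨A, hiA, hjA, φ, χ, -, -, hprod⟩
    obtain rfl : ψ = StabQKD.tensorKet A φ χ := funext hprod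
    obtain ⟨s, hs⟩ := StabQKD.exists_stabilizes_restrict hψ0 hσ
    refine hmin ⟨_, ⟨fun k => ?_, fun h => ?_⟩, Or.inl ?_, hs⟩
    · by_cases hk : k ∈ A
      · exact Or.inl (if_pos hk)
      · exact Or.inr (if_neg hk)
    · exact hj ((congrFun h j).symm.trans (if_neg hjA))
    · exact fun h => hi ((if_pos hiA).symm.trans h)
  · intro hsep
    by_contra hno
    obtain ⟨F⟩ := hψ.nonempty_frame
    have hL := StabQKD.isIsotropic_eigenGroup hψ0
    -- `A` is the connected component of `i` in the graph of the frame.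
    refine hsep ⟨Finset.univ.filter fun k => ∃ m, F.HasWalk i k m, ?_, ?_, ?_⟩
    · simpa using ⟨0, F.hasWalk_refl i⟩
    · simp only [Finset.mem_filter, Finset.mem_univ, true_and]
      rintro ⟨m, hm⟩
      obtain ⟨F', hF'⟩ := F.exists_gen_ne_zero hL hij hm
      exact hno (F'.secureQKDPossible hψ0 hF')
    · obtain ⟨φ, χ, h⟩ := F.exists_eq_tensorKet
        (A := Finset.univ.filter fun k => ∃ m, F.HasWalk i k m) hψ0 fun v => by
          simp only [Finset.mem_filter, Finset.mem_univ, true_and]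
          by_cases hv : ∃ m, F.HasWalk i v m
          · obtain ⟨m, hm⟩ := hv
            exact Or.inl fun k hk => by_contra fun hne => hk ⟨m + 1, hm.succ hne⟩
          · exact Or.inr fun k ⟨m, hm⟩ => by_contra fun hne =>
              hv ⟨m + 1, hm.succ fun e => hne (F.gen_eq_zero_of_symm hL e)⟩
      obtain ⟨φ', χ', h1, h2, h3⟩ := StabQKD.exists_isState_factors (h ▸ hψ.1)
      exact ⟨φ', χ', h1, h2, congrFun (h.trans h3)⟩
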